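/- Let $k$ be a field. An affine $k$-domain is an integral domain that is a finitely generated (commutative) $k$-algebra. For a commutative $k$-algebra $B$, let $\mathrm{PE}_k(B)$ denote the class of all field extensions $K/k$ such that, for some integer $n\ge 0$, there exists an injective homomorphism of $K$-algebras $K\otimes_k B\to K[X_1,\dots,X_n]$ into a polynomial ring in $n$ variables over $K$. Let $B$ be an affine $k$-domain such that $\mathrm{PE}_k(B)\neq\emptyset$. Then: (a) There exists an affine $k$-domain $R$ such that $\operatorname{Frac}(R)/k\in \mathrm{PE}_k(B)$. (b) For every affine $k$-domain $R$ such that $\operatorname{Frac}(R)/k\in \mathrm{PE}_k(B)$, there exists a nonempty open subset $U$ of $\operatorname{Spec} R$ such that $\kappa(\mathfrak p)/k\in \mathrm{PE}_k(B)$ for all $\mathfrak p\in U$, where $\kappa(\mathfrak p)=R_{\mathfrak p}/\mathfrak pR_{\mathfrak p}$. -/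

import Mathlib

open scoped TensorProduct

universe u v w t

/-- `A ⊆ K^[n]`: there is an injective homomorphism of `K`-algebras from `A` to a polynomial
algebra in `n` variables over the field `K`. -/
def EmbedsInPolynomialRing (K : Type*) [Field K] (A : Type*) [CommRing A] [Algebra K A]
    (n : ℕ) : Prop :=
  ∃ f : A →ₐ[K] MvPolynomial (Fin n) K, Function.Injective f

/-- `K/k ∈ PE_k(B)`: the field extension `K/k` belongs to the class of those extensions for which
the `K`-algebra `K ⊗[k] B` embeds in a polynomial ring in finitely many variables over `K`. -/
def InPE (k : Type*) [Field k] (B : Type*) [CommRing B] [Algebra k B]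
    (K : Type*) [Field K] [Algebra k K] : Prop :=
  ∃ n : ℕ, EmbedsInPolynomialRing K (K ⊗[k] B) n

/-! An embedding `f` is determined by its values on finitely many generators of `B`, hence by
finitely many coefficients. For (a), these generate an affine domain in `K`, and injectivity
descends to its fraction field by flatness. For (b), they lie in `S = R[1/r]`, giving an injection
`S ⊗ B → S[X]` of finite type; by Chevalley its image on spectra contains some `D(h)`, `h ≠ 0`.
Where `h` survives in `κ ⊗ B`, a domain, the kernel of `S ⊗ B → κ ⊗ B` is contracted from a prime of
`S[X]`, which forces the fibre map to be injective. -/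

/-- A constructible subset of the spectrum of a domain which contains the generic point contains
a nonempty basic open subset. -/
lemma exists_basicOpen_subset_of_isConstructible {A : Type*} [CommRing A] [IsDomain A]
    {s : Set (PrimeSpectrum A)} (hs : Topology.IsConstructible s) (hbot : ⊥ ∈ s) :
    ∃ h : A, h ≠ 0 ∧ (PrimeSpectrum.basicOpen h : Set (PrimeSpectrum A)) ⊆ s := by
  obtain ⟨S, rfl⟩ := PrimeSpectrum.exists_constructibleSetData_iff.mpr hs
  simp only [PrimeSpectrum.ConstructibleSetData.toSet, Set.mem_iUnion] at hbot
  obtain ⟨C, hC, hg, hf⟩ := hbot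
  -- The piece `D(f) ∩ V(g)` through the generic point has every `g` zero, so it is `D(f)`.
  refine ⟨C.f, fun h0 ↦ hf (by simp [h0]), fun p hp ↦ ?_⟩
  simp only [PrimeSpectrum.ConstructibleSetData.toSet, Set.mem_iUnion]
  refine ⟨C, hC, ?_, by simpa using hp⟩
  rw [PrimeSpectrum.mem_zeroLocus] at hg ⊢
  intro x hx
  have : x = 0 := by simpa using hg hx
  simp [this]

/-- An injective homomorphism of finite presentation from a domain induces a map of spectra whose
image contains a nonempty basic open subset. -/
lemma exists_basicOpen_subset_range_comap {A C : Type*} [CommRing A] [IsDomain A] [CommRing C]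
    {f : A →+* C} (hf : f.FinitePresentation) (hinj : Function.Injective f) :
    ∃ h : A, h ≠ 0 ∧ (PrimeSpectrum.basicOpen h : Set (PrimeSpectrum A)) ⊆
      Set.range (PrimeSpectrum.comap f) := by
  refine exists_basicOpen_subset_of_isConstructible
    (PrimeSpectrum.isConstructible_range_comap hf) ?_
  obtain ⟨q, hq, hqf⟩ := Ideal.exists_comap_eq_of_mem_minimalPrimes_of_injective hinj
    (⊥ : Ideal A) (by simp [IsDomain.minimalPrimes_eq_singleton_bot])
  exact ⟨⟨q, hq⟩, PrimeSpectrum.ext hqf⟩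

section BaseChange

variable {k : Type*} [Field k] {B : Type*} [CommRing B] [Algebra k B]

/-- The base change along `ρ : S → T` of a homomorphism from `B` to a polynomial ring
over `S`. -/
noncomputable def polynomialBaseChange {S T : Type*} [CommRing S] [Algebra k S] [CommRing T]
    [Algebra k T] {n : ℕ} (ρ : S →ₐ[k] T) (ψ : B →ₐ[k] MvPolynomial (Fin n) S) :
    T ⊗[k] B →ₐ[T] MvPolynomial (Fin n) T :=
  Algebra.TensorProduct.lift (Algebra.ofId T _) ((MvPolynomial.mapAlgHom ρ).comp ψ)
    fun _ _ ↦ Commute.all _ _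

@[simp]
lemma polynomialBaseChange_tmul {S T : Type*} [CommRing S] [Algebra k S] [CommRing T]
    [Algebra k T] {n : ℕ} (ρ : S →ₐ[k] T) (ψ : B →ₐ[k] MvPolynomial (Fin n) S) (t : T) (b : B) :
    polynomialBaseChange ρ ψ (t ⊗ₜ b) = MvPolynomial.C t * MvPolynomial.map ρ (ψ b) := by
  simp [polynomialBaseChange, Algebra.ofId_apply, MvPolynomial.algebraMap_eq,
    MvPolynomial.mapAlgHom_apply, MvPolynomial.map]

lemma tensorProduct_map_id_injective {S T : Type*} [CommRing S] [Algebra k S] [CommRing T]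
    [Algebra k T] (ρ : S →ₐ[k] T) (hρ : Function.Injective ρ) :
    Function.Injective (Algebra.TensorProduct.map ρ (AlgHom.id k B)) :=
  Module.Flat.rTensor_preserves_injective_linearMap (M := B) ρ.toLinearMap hρ

lemma polynomialBaseChange_map {S T U : Type*} [CommRing S] [Algebra k S] [CommRing T]
    [Algebra k T] [CommRing U] [Algebra k U] {n : ℕ} (ρ : S →ₐ[k] T) (σ : T →ₐ[k] U)
    (ψ : B →ₐ[k] MvPolynomial (Fin n) S) (x : T ⊗[k] B) :
    polynomialBaseChange (σ.comp ρ) ψ (Algebra.TensorProduct.map σ (AlgHom.id k B) x) =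
      MvPolynomial.map (σ : T →+* U) (polynomialBaseChange ρ ψ x) := by
  induction x with
  | zero => simp
  | add x y hx hy => simp only [map_add, hx, hy]
  | tmul t b =>
    simp only [Algebra.TensorProduct.map_tmul, AlgHom.id_apply, polynomialBaseChange_tmul, map_mul,
      MvPolynomial.map_C, MvPolynomial.map_map]
    rfl

lemma polynomialBaseChange_injective_of_comp {S T U : Type*} [CommRing S] [Algebra k S]
    [CommRing T] [Algebra k T] [CommRing U] [Algebra k U] {n : ℕ} (ρ : S →ₐ[k] T) (σ : T →ₐ[k] U)
    (hσ : Function.Injective σ) (ψ : B →ₐ[k] MvPolynomial (Fin n) S)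
    (h : Function.Injective (polynomialBaseChange (σ.comp ρ) ψ)) :
    Function.Injective (polynomialBaseChange ρ ψ) := fun x y hxy ↦
  tensorProduct_map_id_injective σ hσ <| h <| by
    rw [polynomialBaseChange_map, polynomialBaseChange_map, hxy]

/-- A homomorphism from `B` to a polynomial ring over `F` descends to a subring `S` of `F` which
contains the coefficients of the images of generators of `B`. -/
lemma exists_descent_of_coeffs_subset {S F : Type*} [CommRing S] [Algebra k S] [CommRing F]
    [Algebra k F] {n : ℕ} (ρ : S →ₐ[k] F) (hρ : Function.Injective ρ)
    (φ : B →ₐ[k] MvPolynomial (Fin n) F) (G : Set B) (hG : Algebra.adjoin k G = ⊤)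
    (hc : ∀ b ∈ G, ∀ m, (φ b).coeff m ∈ Set.range ρ) :
    ∃ ψ : B →ₐ[k] MvPolynomial (Fin n) S, (MvPolynomial.mapAlgHom ρ).comp ψ = φ := by
  have hinj : Function.Injective (MvPolynomial.mapAlgHom (σ := Fin n) ρ) :=
    MvPolynomial.map_injective (ρ : S →+* F) hρ
  have hrange : φ.range ≤ (MvPolynomial.mapAlgHom (σ := Fin n) ρ).range := by
    rw [← Algebra.map_top, ← hG, AlgHom.map_adjoin, Algebra.adjoin_le_iff]
    rintro _ ⟨b, hb, rfl⟩
    have := MvPolynomial.mem_range_map_iff_coeffs_subset (f := (ρ : S →+* F)) (x := φ b)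
    refine this.mpr fun c hc' ↦ ?_
    obtain ⟨m, -, rfl⟩ := MvPolynomial.mem_coeffs_iff.mp hc'
    exact hc b hb m
  refine ⟨((AlgEquiv.ofInjective _ hinj).symm : _ →ₐ[k] _).comp
    ((Subalgebra.inclusion hrange).comp φ.rangeRestrict), ?_⟩
  ext1 b
  exact congrArg Subtype.val ((AlgEquiv.ofInjective _ hinj).apply_symm_apply
    (Subalgebra.inclusion hrange (φ.rangeRestrict b)))

/-- A homomorphism of `F`-algebras on `F ⊗ B` is determined by its restriction to `B`. -/
lemma polynomialBaseChange_eq_of_comp_eq {S F : Type*} [CommRing S] [Algebra k S] [CommRing F]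
    [Algebra k F] {n : ℕ} (ρ : S →ₐ[k] F) (ψ : B →ₐ[k] MvPolynomial (Fin n) S)
    (f : F ⊗[k] B →ₐ[F] MvPolynomial (Fin n) F)
    (h : (MvPolynomial.mapAlgHom ρ).comp ψ =
      (f.restrictScalars k).comp Algebra.TensorProduct.includeRight) :
    polynomialBaseChange ρ ψ = f := by
  refine Algebra.TensorProduct.ext (by ext) (AlgHom.ext fun b ↦ ?_)
  have := DFunLike.congr_fun h b
  simpa [polynomialBaseChange] using this

/-- Coordinates in a `k`-basis of `B` commute with base change; `c` is a nonzero coordinate of `h`.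
-/
lemma exists_ne_zero_forall_map_eq_zero {S : Type*} [CommRing S] [Algebra k S] {h : S ⊗[k] B}
    (hh : h ≠ 0) :
    ∃ c : S, c ≠ 0 ∧ ∀ (T : Type w) [CommRing T] [Algebra k T] (ρ : S →ₐ[k] T),
      Algebra.TensorProduct.map ρ (AlgHom.id k B) h = 0 → ρ c = 0 := by
  let b := Module.Basis.ofVectorSpace k B
  have hb : (Algebra.TensorProduct.basis S b).repr h ≠ 0 := by simpa using hh
  obtain ⟨i, hi⟩ := Finsupp.ne_iff.mp hb
  refine ⟨_, hi, fun T _ _ ρ hρ ↦ ?_⟩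
  have key (x : S ⊗[k] B) : ρ ((Algebra.TensorProduct.basis S b).repr x i) =
      (Algebra.TensorProduct.basis T b).repr
        (Algebra.TensorProduct.map ρ (AlgHom.id k B) x) i := by
    induction x with
    | zero => simp
    | add x y hx hy => simp only [map_add, Finsupp.add_apply, hx, hy]
    | tmul s y => simp [Algebra.TensorProduct.basis_repr_tmul]
  rw [key, hρ]
  simp

/-- Injectivity of `B ⊗ S → S[X]` spreads out to the points of a nonempty open subset
of `Spec S`. -/
lemma exists_ne_zero_forall_polynomialBaseChange_injective {S : Type*} [CommRing S] [IsDomain S]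
    [Algebra k S] [Algebra.FiniteType k S] [Algebra.FiniteType k B] {n : ℕ}
    (ψ : B →ₐ[k] MvPolynomial (Fin n) S)
    (hψ : Function.Injective (polynomialBaseChange (AlgHom.id k S) ψ)) :
    ∃ c : S, c ≠ 0 ∧ ∀ (κ : Type w) [Field κ] [Algebra k κ] [IsDomain (κ ⊗[k] B)]
      (ρ : S →ₐ[k] κ), ρ c ≠ 0 → (∀ z : κ, ∃ s t, ρ s ≠ 0 ∧ ρ s * z = ρ t) →
      Function.Injective (polynomialBaseChange ρ ψ) := by
  let Φ : S ⊗[k] B →ₐ[S] MvPolynomial (Fin n) S := polynomialBaseChange (AlgHom.id k S) ψ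
  have : IsDomain (S ⊗[k] B) := Function.Injective.isDomain Φ.toRingHom hψ
  have : IsNoetherianRing S := Algebra.FiniteType.isNoetherianRing k S
  have : IsNoetherianRing (S ⊗[k] B) := Algebra.FiniteType.isNoetherianRing S _
  have hfin : (Φ : S ⊗[k] B →+* MvPolynomial (Fin n) S).FiniteType := by
    refine RingHom.FiniteType.of_comp_finiteType (f := algebraMap S (S ⊗[k] B)) ?_
    have : (Φ : S ⊗[k] B →+* MvPolynomial (Fin n) S).comp (algebraMap S (S ⊗[k] B)) =
      algebraMap S _ := Φ.comp_algebraMap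
    rw [this, RingHom.finiteType_algebraMap]
    infer_instance
  obtain ⟨h, hh0, hh⟩ := exists_basicOpen_subset_range_comap
    (RingHom.FinitePresentation.of_finiteType.mp hfin) hψ
  obtain ⟨c, hc0, hc⟩ := exists_ne_zero_forall_map_eq_zero hh0
  refine ⟨c, hc0, fun κ _ _ _ ρ hρc hfrac ↦ ?_⟩
  let π := Algebra.TensorProduct.map ρ (AlgHom.id k B)
  let P : PrimeSpectrum (S ⊗[k] B) := ⟨RingHom.ker π, RingHom.ker_isPrime π⟩
  obtain ⟨Q, hQ⟩ := hh (show P ∈ PrimeSpectrum.basicOpen h from fun hP ↦ hρc (hc κ ρ hP))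
  have hQP (a : S ⊗[k] B) : Φ a ∈ Q.asIdeal ↔ π a = 0 := by
    change a ∈ (PrimeSpectrum.comap (Φ : S ⊗[k] B →+* MvPolynomial (Fin n) S) Q).asIdeal ↔ _
    rw [hQ]
    rfl
  -- `Q` contracts to `ker π`, so it contains `ker ρ` and its extension to `S[X]`.
  have hker (p : MvPolynomial (Fin n) S) (hp : MvPolynomial.map (ρ : S →+* κ) p = 0) :
      p ∈ Q.asIdeal := by
    have hp' : p ∈ RingHom.ker (MvPolynomial.map (σ := Fin n) (ρ : S →+* κ)) := hp
    rw [MvPolynomial.ker_map] at hp'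
    refine Ideal.map_le_iff_le_comap.mpr (fun s hs ↦ ?_) hp'
    have h1 : Φ (s ⊗ₜ 1) ∈ Q.asIdeal := by
      have hs : ρ s = 0 := hs
      rw [hQP]
      simp [π, hs]
    simpa [Φ] using h1
  -- Denominators clear because `κ` is the fraction field of `ρ(S)`.
  have hlift (z : κ ⊗[k] B) : ∃ s a, ρ s ≠ 0 ∧ ρ s • z = π a := by
    induction z with
    | zero => exact ⟨1, 0, by simp, by simp⟩
    | tmul z b =>
      obtain ⟨s, t, hs, hst⟩ := hfrac z
      exact ⟨s, t ⊗ₜ b, hs, by simp [π, TensorProduct.smul_tmul', hst]⟩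
    | add x y hx hy =>
      obtain ⟨s, a, hs, hsa⟩ := hx
      obtain ⟨t, b, ht, htb⟩ := hy
      refine ⟨s * t, t • a + s • b, by simp [hs, ht], ?_⟩
      have hπ (r : S) (x : S ⊗[k] B) : π (r • x) = ρ r • π x := by
        rw [Algebra.smul_def, Algebra.smul_def, map_mul]
        simp [π, Algebra.TensorProduct.algebraMap_apply]
      rw [map_add, hπ, hπ, ← hsa, ← htb, map_mul, smul_add, smul_smul, smul_smul, mul_comm (ρ t)]
  rw [injective_iff_map_eq_zero]
  intro z hz
  obtain ⟨s, a, hs, hsa⟩ := hlift z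
  have h1 : polynomialBaseChange ρ ψ (π a) = 0 := by rw [← hsa, map_smul, hz, smul_zero]
  have h2 := polynomialBaseChange_map (AlgHom.id k S) ρ ψ a
  rw [AlgHom.comp_id, h1] at h2
  rw [(hQP a).mp (hker _ h2.symm)] at hsa
  exact (smul_eq_zero.mp hsa).resolve_left hs

lemma InPE.of_extension {K L : Type*} [Field K] [Algebra k K] [Field L] [Algebra k L] [Algebra K L]
    [IsScalarTower k K L] (h : InPE k B K) : InPE k B L := by
  obtain ⟨n, f, hf⟩ := h
  have hinj : Function.Injective (Algebra.TensorProduct.map (AlgHom.id L L) f) :=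
    Module.Flat.lTensor_preserves_injective_linearMap (M := L) f.toLinearMap hf
  exact ⟨n, ((MvPolynomial.algebraTensorAlgEquiv K L).toAlgHom.comp
    (Algebra.TensorProduct.map (AlgHom.id L L) f)).comp
    (Algebra.TensorProduct.cancelBaseChange k K L L B).symm.toAlgHom,
    ((MvPolynomial.algebraTensorAlgEquiv K L).injective.comp hinj).comp
      (Algebra.TensorProduct.cancelBaseChange k K L L B).symm.injective⟩

/-- If `B` embeds in a polynomial ring after some field extension, then `B` remains a domain after
every field extension. -/
lemma InPE.isDomain_tensorProduct {K : Type*} [Field K] [Algebra k K] (h : InPE k B K)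
    (κ : Type*) [Field κ] [Algebra k κ] : IsDomain (κ ⊗[k] B) := by
  -- The field `Ω` contains both `κ` and `K`, so `κ ⊗ B ⊆ Ω ⊗ B ⊆ Ω[X]`.
  obtain ⟨m, hm⟩ := Ideal.exists_maximal (κ ⊗[k] K)
  let Ω := (κ ⊗[k] K) ⧸ m
  let _ : Field Ω := Ideal.Quotient.field m
  let i : K →ₐ[k] Ω := (Ideal.Quotient.mkₐ k m).comp Algebra.TensorProduct.includeRight
  let j : κ →ₐ[k] Ω := (Ideal.Quotient.mkₐ k m).comp Algebra.TensorProduct.includeLeft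
  let _ : Algebra K Ω := i.toRingHom.toAlgebra
  have : IsScalarTower k K Ω := IsScalarTower.of_algebraMap_eq' i.comp_algebraMap.symm
  obtain ⟨n, f, hf⟩ := h.of_extension (L := Ω)
  exact Function.Injective.isDomain
    (f.toRingHom.comp (Algebra.TensorProduct.map j (AlgHom.id k B)).toRingHom)
    (hf.comp (tensorProduct_map_id_injective j j.toRingHom.injective))

lemma InPE.of_injective {S K L : Type*} [CommRing S] [Algebra k S] [Field K] [Algebra k K] [Field L]
    [Algebra k L] {n : ℕ} (ρ : S →ₐ[k] L) (σ : L →ₐ[k] K) (ψ : B →ₐ[k] MvPolynomial (Fin n) S)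
    (h : Function.Injective (polynomialBaseChange (σ.comp ρ) ψ)) : InPE k B L :=
  ⟨n, _, polynomialBaseChange_injective_of_comp ρ σ σ.toRingHom.injective ψ h⟩

end BaseChange

lemma InPE.exists_finiteType {k : Type u} [Field k] {B : Type*} [CommRing B] [Algebra k B]
    [Algebra.FiniteType k B] {K : Type*} [Field K] [Algebra k K] (h : InPE k B K) :
    ∃ (R : Type u) (_ : CommRing R) (_ : Algebra k R) (_ : IsDomain R)
      (_ : Algebra.FiniteType k R), InPE k B (FractionRing R) := by
  classical
  obtain ⟨n, f, hf⟩ := h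
  let φ := (f.restrictScalars k).comp (Algebra.TensorProduct.includeRight : B →ₐ[k] K ⊗[k] B)
  obtain ⟨G, hG⟩ := (Algebra.FiniteType.out : (⊤ : Subalgebra k B).FG)
  let c : Finset K := G.biUnion fun b ↦ (φ b).coeffs
  let ev : MvPolynomial (Fin c.card) k →ₐ[k] K := MvPolynomial.aeval fun i ↦ (c.equivFin.symm i : K)
  -- A copy of `k[c] ⊆ K`, taken as a quotient so that it lives in the universe of `k`.
  let R := MvPolynomial (Fin c.card) k ⧸ RingHom.ker ev
  let ρ : R →ₐ[k] K := Ideal.kerLiftAlg ev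
  have hρ : Function.Injective ρ := Ideal.kerLiftAlg_injective ev
  have : IsDomain R := Function.Injective.isDomain ρ.toRingHom hρ
  have hcoeff : ∀ b ∈ (G : Set B), ∀ m, (φ b).coeff m ∈ Set.range ρ := by
    intro b hb m
    by_cases h0 : (φ b).coeff m = 0
    · exact ⟨0, by simp [h0]⟩
    have hm : (φ b).coeff m ∈ c :=
      Finset.mem_biUnion.mpr ⟨b, hb, MvPolynomial.coeff_mem_coeffs m h0⟩
    exact ⟨Ideal.Quotient.mk _ (MvPolynomial.X (c.equivFin ⟨_, hm⟩)),
      (Ideal.kerLiftAlg_mk ev _).trans (by simp [ev])⟩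
  obtain ⟨ψ, hψ⟩ := exists_descent_of_coeffs_subset ρ hρ φ G hG hcoeff
  let σ : FractionRing R →ₐ[k] K := IsFractionRing.liftAlgHom hρ
  have hσ : σ.comp (IsScalarTower.toAlgHom k R (FractionRing R)) = ρ := by
    ext x
    simp [σ]
  refine ⟨R, inferInstance, inferInstance, this, inferInstance,
    InPE.of_injective (IsScalarTower.toAlgHom k R (FractionRing R)) σ ψ ?_⟩
  rw [hσ, polynomialBaseChange_eq_of_comp_eq ρ ψ f hψ]
  exact hf

lemma InPE.exists_isOpen_residueField {k : Type*} [Field k] {B : Type*} [CommRing B] [Algebra k B]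
    [Algebra.FiniteType k B] {R : Type*} [CommRing R] [Algebra k R] [IsDomain R]
    [Algebra.FiniteType k R] (h : InPE k B (FractionRing R)) :
    ∃ U : Set (PrimeSpectrum R), IsOpen U ∧ U.Nonempty ∧
      ∀ p ∈ U, InPE k B p.asIdeal.ResidueField := by
  classical
  have hdom := h
  obtain ⟨n, f, hf⟩ := h
  set F := FractionRing R
  let φ := (f.restrictScalars k).comp (Algebra.TensorProduct.includeRight : B →ₐ[k] F ⊗[k] B)
  obtain ⟨G, hG⟩ := (Algebra.FiniteType.out : (⊤ : Subalgebra k B).FG)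
  -- `r` is a common denominator of the coefficients.
  obtain ⟨⟨r, hr⟩, hrc⟩ := IsLocalization.exist_integer_multiples_of_finset (nonZeroDivisors R)
    (G.biUnion fun b ↦ (φ b).coeffs : Finset F)
  have hr0 : r ≠ 0 := nonZeroDivisors.ne_zero hr
  let S := Localization.Away r
  have hle : Submonoid.powers r ≤ nonZeroDivisors R :=
    powers_le_nonZeroDivisors_of_noZeroDivisors hr0
  have : IsDomain S := IsLocalization.isDomain_localization hle
  have : Algebra.FiniteType R S := IsLocalization.finiteType_of_monoid_fg (Submonoid.powers r) S
  have : Algebra.FiniteType k S := .trans (S := R) inferInstance inferInstance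
  have hunit : ∀ y : Submonoid.powers r, IsUnit (IsScalarTower.toAlgHom k R F y) := fun y ↦
    IsLocalization.map_units F (⟨y, hle y.2⟩ : nonZeroDivisors R)
  let ρ : S →ₐ[k] F := IsLocalization.liftAlgHom (M := Submonoid.powers r) hunit
  have hρR (x : R) : ρ (algebraMap R S x) = algebraMap R F x := by simp [ρ]
  have hρ : Function.Injective ρ := by
    rw [injective_iff_map_eq_zero]
    intro x hx
    obtain ⟨a, s, rfl⟩ := IsLocalization.exists_mk'_eq (Submonoid.powers r) x
    have h1 : ρ (algebraMap R S a) = 0 := by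
      rw [← IsLocalization.mk'_spec S a s, map_mul, hx, zero_mul]
    rw [hρR, map_eq_zero_iff _ (IsFractionRing.injective R F)] at h1
    simp [h1]
  have hcoeff : ∀ b ∈ (G : Set B), ∀ m, (φ b).coeff m ∈ Set.range ρ := by
    intro b hb m
    by_cases h0 : (φ b).coeff m = 0
    · exact ⟨0, by simp [h0]⟩
    obtain ⟨a, ha⟩ := hrc _ (Finset.mem_biUnion.mpr ⟨b, hb, MvPolynomial.coeff_mem_coeffs m h0⟩)
    refine ⟨IsLocalization.mk' S a ⟨r, Submonoid.mem_powers r⟩, ?_⟩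
    have hrF : algebraMap R F r ≠ 0 := by simpa using hr0
    refine mul_right_cancel₀ hrF ?_
    rw [← hρR r, ← map_mul]
    erw [IsLocalization.mk'_spec S a ⟨r, Submonoid.mem_powers r⟩]
    rw [hρR, hρR, ha, mul_comm]
    simp [Algebra.smul_def]
  obtain ⟨ψ, hψ⟩ := exists_descent_of_coeffs_subset ρ hρ φ G hG hcoeff
  have hinj : Function.Injective (polynomialBaseChange (AlgHom.id k S) ψ) := by
    refine polynomialBaseChange_injective_of_comp _ ρ hρ ψ ?_
    rw [AlgHom.comp_id, polynomialBaseChange_eq_of_comp_eq ρ ψ f hψ]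
    exact hf
  obtain ⟨c, hc0, hc⟩ := exists_ne_zero_forall_polynomialBaseChange_injective ψ hinj
  obtain ⟨a, s, rfl⟩ := IsLocalization.exists_mk'_eq (Submonoid.powers r) c
  have ha0 : a ≠ 0 := by
    rintro rfl
    simp at hc0
  -- Off `V(r)` the map `R → κ(p)` extends to `S`; off `V(a)` the element `c = a/s` stays nonzero.
  refine ⟨PrimeSpectrum.basicOpen (r * a), (PrimeSpectrum.basicOpen _).isOpen,
    ⟨⊥, by simp [hr0, ha0]⟩, fun p hp ↦ ?_⟩
  have hp : r * a ∉ p.asIdeal := hp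
  have hrp : r ∉ p.asIdeal := fun h ↦ hp (Ideal.mul_mem_right _ _ h)
  have hap : a ∉ p.asIdeal := fun h ↦ hp (Ideal.mul_mem_left _ _ h)
  let κ := p.asIdeal.ResidueField
  have hunit' : ∀ y : Submonoid.powers r, IsUnit (IsScalarTower.toAlgHom k R κ y) := by
    rintro ⟨_, e, rfl⟩
    have hr : algebraMap R κ r ≠ 0 := by rwa [Ne, Ideal.algebraMap_residueField_eq_zero]
    simpa only [IsScalarTower.coe_toAlgHom', map_pow] using hr.isUnit.pow e
  let τ : S →ₐ[k] κ := IsLocalization.liftAlgHom (M := Submonoid.powers r) hunit'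
  have hτR (x : R) : τ (algebraMap R S x) = algebraMap R κ x := by simp [τ]
  have := hdom.isDomain_tensorProduct κ
  refine ⟨n, _, hc κ τ (fun h0 ↦ hap ?_) fun z ↦ ?_⟩
  · rw [← Ideal.algebraMap_residueField_eq_zero, ← hτR, ← IsLocalization.mk'_spec S a s, map_mul,
      h0, zero_mul]
  · obtain ⟨x, y, hy, rfl⟩ := IsFractionRing.div_surjective (A := R ⧸ p.asIdeal) z
    obtain ⟨x, rfl⟩ := Ideal.Quotient.mk_surjective x
    obtain ⟨y, rfl⟩ := Ideal.Quotient.mk_surjective y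
    have hy0 : algebraMap R κ y ≠ 0 := by
      rw [Ne, Ideal.algebraMap_residueField_eq_zero, ← Ideal.Quotient.eq_zero_iff_mem]
      exact nonZeroDivisors.ne_zero hy
    refine ⟨algebraMap R S y, algebraMap R S x, by rwa [hτR], ?_⟩
    rw [hτR, hτR, Ideal.algebraMap_quotient_residueField_mk,
      Ideal.algebraMap_quotient_residueField_mk, mul_div_cancel₀ _ hy0]

theorem mainTheorem5 (k : Type u) [Field k] (B : Type v) [CommRing B] [Algebra k B]
    [IsDomain B] [Algebra.FiniteType k B]
    (hPE : ∃ (K : Type w) (_ : Field K) (_ : Algebra k K), InPE k B K) :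
    (∃ (R : Type u) (_ : CommRing R) (_ : Algebra k R) (_ : IsDomain R)
        (_ : Algebra.FiniteType k R), InPE k B (FractionRing R)) ∧
      ∀ (R : Type t) [CommRing R] [Algebra k R] [IsDomain R] [Algebra.FiniteType k R],
        InPE k B (FractionRing R) →
          ∃ U : Set (PrimeSpectrum R), IsOpen U ∧ U.Nonempty ∧
            ∀ p ∈ U, InPE k B p.asIdeal.ResidueField := by
  obtain ⟨K, _, _, hK⟩ := hPE
  exact ⟨hK.exists_finiteType, fun R _ _ _ _ hR ↦ hR.exists_isOpen_residueField⟩
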